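/- Let $\mathcal X$ be a set of datasets with a symmetric neighbouring relation $\sim$ under which some two distinct datasets are neighbours. A mechanism $M$ assigns to each $x\in\mathcal X$ a probability distribution $M(x)$ on an outcome space $\mathcal Y$ (an arbitrary measurable space). $M$ is $(\varepsilon,\delta)$-DP if $\Pr[M(x)\in S]\le e^{\varepsilon}\Pr[M(x')\in S]+\delta$ for all $x\sim x'$ and all events $S$; it is $\varepsilon$-DP if it is $(\varepsilon,0)$-DP. $M$ is $\varepsilon$-bounded range ($\varepsilon$-BR) if $\frac{\Pr[M(x)=y_1]}{\Pr[M(x')=y_1]}\le e^{\varepsilon}\frac{\Pr[M(x)=y_2]}{\Pr[M(x')=y_2]}$ for all $x\sim x'$ and all outcomes $y_1,y_2$; for general outcome spaces this is read as $\Pr[M(x)\in S_1]\Pr[M(x')\in S_2]\le e^{\varepsilon}\Pr[M(x)\in S_2]\Pr[M(x')\in S_1]$ for all events $S_1,S_2$. Let $\mathcal M_{\mathrm{DP}}$ and $\mathcal M_{\mathrm{BR}}$ be the classes of all $\varepsilon$-DP and all $\varepsilon$-BR mechanisms. For classes $\mathcal C_1,\mathcal C_2,\mathcal C_3$ let $(\mathcal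 C_1,\mathcal C_2,\mathcal C_3)$ be the class of adaptive compositions: on input $x$ draw $y_1\sim M_1(x)$, then $y_2\sim M_2(x,y_1)$, then $y_3\sim M_3(x,y_1,y_2)$, and output $(y_1,y_2,y_3)$, where $M_1\in\mathcal C_1$, and $M_2(\cdot,y_1)\in\mathcal C_2$, $M_3(\cdot,y_1,y_2)\in\mathcal C_3$ for all fixed $y_1,y_2$ (and $M_2,M_3$ depend measurably on the earlier outcomes). Put $\delta_{\mathrm{opt}}(M;\varepsilon_g)=\inf\{\delta\ge 0: M\text{ is }(\varepsilon_g,\delta)\text{-DP}\}$ and $\delta_{\mathrm{opt}}(\mathcal C;\varepsilon_g)=\sup_{M\in\mathcal C}\delta_{\mathrm{opt}}(M;\varepsilon_g)$. **Lemma.** Let $\varepsilon>0$ and $\varepsilon_g\ge 0$. (1) If $\varepsilon_g\ge\varepsilon$, then $$\delta_{\mathrm{opt}}(\mathcal M_{\mathrm{BR}},\mathcal M_{\mathrm{BR}},\mathcal M_{\mathrm{DP}};\varepsilon_g)=\delta_{\mathrm{opt}}(\mathcal M_{\mathrm{BR}},\mathcal M_{\mathrm{DP}},\mathcal M_{\mathrm{BR}};\varepsilon_g)=\delta_{\mathrm{opt}}(\mathcal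 M_{\mathrm{DP}},\mathcal M_{\mathrm{BR}},\mathcal M_{\mathrm{BR}};\varepsilon_g).$$ (2) If $\varepsilon_g\le\varepsilon$, let $q_{a,t}=\frac{1-e^{t-a}}{1-e^{-a}}$ and $$x(t)=q_{2\varepsilon,\varepsilon}\Big(q_{\varepsilon,t}\,q_{\varepsilon,\frac{\varepsilon_g-t}{2}}^2(1-e^{-\varepsilon})+(1-q_{\varepsilon,t})\,q_{\varepsilon,\frac{\varepsilon_g+\varepsilon-t}{2}}^2(1-e^{-\varepsilon})\Big),$$ $$y(t)=q_{2\varepsilon,\varepsilon}\Big(q_{\varepsilon,t}(1-e^{\varepsilon_g-\varepsilon-t})+(1-q_{\varepsilon,t})\,q_{\varepsilon,\frac{\varepsilon_g+\varepsilon-t}{2}}^2(1-e^{-\varepsilon})\Big),$$ $$z(t)=(1-q_{2\varepsilon,\varepsilon})\,q_{\varepsilon,t}\,q_{\varepsilon,\varepsilon+\frac{\varepsilon_g-t}{2}}^2(1-e^{-\varepsilon}).$$ Then $$\delta_{\mathrm{opt}}(\mathcal M_{\mathrm{DP}},\mathcal M_{\mathrm{BR}},\mathcal M_{\mathrm{BR}};\varepsilon_g)=\max\Big\{\sup_{t\in[0,\varepsilon_g)}x(t),\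 \sup_{t\in[\varepsilon_g,\varepsilon]}y(t)\Big\}+\sup_{t'\in[\varepsilon_g,\varepsilon]}z(t'),$$ $$\delta_{\mathrm{opt}}(\mathcal M_{\mathrm{BR}},\mathcal M_{\mathrm{DP}},\mathcal M_{\mathrm{BR}};\varepsilon_g)=\max\Big\{\sup_{t\in[0,\varepsilon_g)}x(t),\ \sup_{t\in[\varepsilon_g,\varepsilon]}\big(y(t)+z(t)\big)\Big\},$$ $$\delta_{\mathrm{opt}}(\mathcal M_{\mathrm{BR}},\mathcal M_{\mathrm{BR}},\mathcal M_{\mathrm{DP}};\varepsilon_g)=\max\Big\{\sup_{t\in[0,\varepsilon_g)}x(t),\ \sup_{t\in[\varepsilon_g,\varepsilon]}\big(y(t)+z(t)\big)\Big\},$$ where for $\varepsilon_g=0$ the supremum over the empty set $[0,0)$ is read as $0$ (equivalently, omitted from the maximum). -/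

import Mathlib

open MeasureTheory ProbabilityTheory
open scoped ENNReal

noncomputable section

namespace PrivacyComp

universe u

/-- A class of mechanisms with inputs in `X`: for every outcome space `Y`, a predicate on families
`M : X → Measure Y`, where `M x` is the law of the output of the mechanism on the dataset `x`. -/
abbrev MechClass (X : Type u) : Type (max u 1) :=
  ∀ (Y : Type) [MeasurableSpace Y], (X → Measure Y) → Prop

/-- `(ε, δ)`-differential privacy of `M` for the neighbouring relation `Adj`. -/
def IsDP {X : Type u} (Adj : X → X → Prop) {Y : Type} [MeasurableSpace Y]
    (M : X → Measure Y) (ε δ : ℝ) : Prop :=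
  ∀ x x', Adj x x' → ∀ S : Set Y, MeasurableSet S →
    (M x).real S ≤ Real.exp ε * (M x').real S + δ

/-- `ε`-bounded range: `Pr[M x = y₁] / Pr[M x' = y₁] ≤ e^ε Pr[M x = y₂] / Pr[M x' = y₂]`.
The inequality is cleared of denominators and written for events `S₁, S₂` in place of outcomes, so
that it makes sense for all outcome spaces. For discrete outcomes summing over
`y₁ ∈ S₁`, `y₂ ∈ S₂` shows that this is the condition on outcomes; for laws with densities it is
the condition on the densities (almost everywhere). -/
def IsBR {X : Type u} (Adj : X → X → Prop) {Y : Type} [MeasurableSpace Y]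
    (M : X → Measure Y) (ε : ℝ) : Prop :=
  ∀ x x', Adj x x' → ∀ S₁ S₂ : Set Y, MeasurableSet S₁ → MeasurableSet S₂ →
    (M x).real S₁ * (M x').real S₂ ≤ Real.exp ε * ((M x).real S₂ * (M x').real S₁)

/-- The class of all `ε`-DP mechanisms. -/
def DP {X : Type u} (Adj : X → X → Prop) (ε : ℝ) : MechClass X :=
  fun _ _ M => (∀ x, IsProbabilityMeasure (M x)) ∧ IsDP Adj M ε 0

/-- The class of all `ε`-BR mechanisms. -/
def BR {X : Type u} (Adj : X → X → Prop) (ε : ℝ) : MechClass X :=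
  fun _ _ M => (∀ x, IsProbabilityMeasure (M x)) ∧ IsBR Adj M ε

/-- The class `(C₁, C₂, C₃)` of adaptive compositions: on the dataset `x` one draws
`y₁` from `M₁ x`, then `y₂` from `M₂ x y₁`, then `y₃` from `M₃ x (y₁, y₂)`, and releases
`((y₁, y₂), y₃)`. For all fixed earlier outcomes the next mechanism belongs to its class. -/
inductive Adaptive {X : Type u} (C₁ C₂ C₃ : MechClass X) : MechClass X
  | mk {Y₁ Y₂ Y₃ : Type} [MeasurableSpace Y₁] [MeasurableSpace Y₂] [MeasurableSpace Y₃]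
      (M₁ : X → Measure Y₁) (M₂ : X → Kernel Y₁ Y₂) (M₃ : X → Kernel (Y₁ × Y₂) Y₃)
      (h₁ : C₁ Y₁ M₁)
      (h₂ : ∀ y₁, C₂ Y₂ (fun x => M₂ x y₁))
      (h₃ : ∀ y, C₃ Y₃ (fun x => M₃ x y)) :
      Adaptive C₁ C₂ C₃ ((Y₁ × Y₂) × Y₃) (fun x => (M₁ x ⊗ₘ M₂ x) ⊗ₘ M₃ x)

/-- The optimal `δ` of a single mechanism. -/
def deltaOptMech {X : Type u} (Adj : X → X → Prop) {Y : Type} [MeasurableSpace Y]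
    (M : X → Measure Y) (εg : ℝ) : ℝ :=
  sInf {δ : ℝ | 0 ≤ δ ∧ IsDP Adj M εg δ}

/-- The optimal `δ` of a class of mechanisms: the supremum over all its members. -/
def deltaOpt {X : Type u} (Adj : X → X → Prop) (C : MechClass X) (εg : ℝ) : ℝ :=
  sSup {d : ℝ | ∃ (Y : Type) (_ : MeasurableSpace Y) (M : X → Measure Y),
    C Y M ∧ d = deltaOptMech Adj M εg}

/-- The probability `q_{ε,t}` that generalized randomized response maps `0` to `0`. -/
def q (ε t : ℝ) : ℝ := (1 - Real.exp (t - ε)) / (1 - Real.exp (-ε))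

def xFun (ε εg t : ℝ) : ℝ :=
  q (2 * ε) ε *
    (q ε t * q ε ((εg - t) / 2) ^ 2 * (1 - Real.exp (-ε))
      + (1 - q ε t) * q ε ((εg + ε - t) / 2) ^ 2 * (1 - Real.exp (-ε)))

def yFun (ε εg t : ℝ) : ℝ :=
  q (2 * ε) ε *
    (q ε t * (1 - Real.exp (εg - ε - t))
      + (1 - q ε t) * q ε ((εg + ε - t) / 2) ^ 2 * (1 - Real.exp (-ε)))

def zFun (ε εg t : ℝ) : ℝ :=
  (1 - q (2 * ε) ε) * q ε t * q ε (ε + (εg - t) / 2) ^ 2 * (1 - Real.exp (-ε))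

end PrivacyComp

end

/-!
For two neighbouring datasets an `ε`-BR mechanism has its privacy loss in an interval
`[t - ε, t]` with `0 ≤ t ≤ ε`, and an `ε`-DP mechanism has it in `[-ε, ε]`. Among all mechanisms
with loss in `[t - a, t]`, generalized randomized response, whose loss only takes the two extreme
values, is the worst, even when it is followed by further adaptive mechanisms. The optimal `δ` of
an adaptive composition is therefore obtained by applying, from the last stage to the first, the
operators sending a function `f` to the function
`s ↦ sup_t (q_{a,t} f(s - t) + (1 - q_{a,t}) f(s - t + a))`, where `a = 2ε`, `t = ε` for a DP stage
and `a = ε`, `0 ≤ t ≤ ε` for a BR stage.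

The closed formula for the last BR stage is the inequality of arithmetic and geometric means, with
equality at the midpoint `t = (s + ε) / 2`. A DP stage can be moved past a BR supremum as soon as
one of its two terms does not depend on the parameter of the BR stage: this always happens when
these are the last two stages, and for `εg ≥ ε` also when one further BR stage follows.
-/

namespace PrivacyComp

section Real

variable {a c t : ℝ}

theorem one_sub_exp_neg_pos (ha : 0 < a) : 0 < 1 - Real.exp (-a) := by
  simpa using ha

theorem q_mul_one_sub_exp_neg (ha : 0 < a) (t : ℝ) :
    q a t * (1 - Real.exp (-a)) = 1 - Real.exp (t - a) :=
  div_mul_cancel₀ _ (one_sub_exp_neg_pos ha).ne'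

theorem q_mem_Icc (ha : 0 < a) (ht : t ∈ Set.Icc 0 a) : q a t ∈ Set.Icc 0 1 := by
  have hlow : Real.exp (-a) ≤ Real.exp (t - a) := Real.exp_le_exp.2 (by linarith [ht.1])
  have hup : Real.exp (t - a) ≤ 1 := Real.exp_le_one_iff.2 (by linarith [ht.2])
  exact ⟨div_nonneg (by linarith) (one_sub_exp_neg_pos ha).le,
    (div_le_one (one_sub_exp_neg_pos ha)).2 (by linarith)⟩

@[fun_prop]
theorem continuous_q (a : ℝ) : Continuous (q a) := by
  unfold q; fun_prop

theorem q_zero (ha : 0 < a) : q a 0 = 1 := by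
  rw [q, zero_sub, div_self (one_sub_exp_neg_pos ha).ne']

theorem one_sub_exp_mul_le_sq (u v : ℝ) :
    (1 - Real.exp u) * (1 - Real.exp v) ≤ (1 - Real.exp ((u + v) / 2)) ^ 2 := by
  have hu : Real.exp u = Real.exp (u / 2) ^ 2 := by rw [← Real.exp_nat_mul]; ring_nf
  have hv : Real.exp v = Real.exp (v / 2) ^ 2 := by rw [← Real.exp_nat_mul]; ring_nf
  rw [add_div, Real.exp_add, hu, hv]
  linear_combination sq_nonneg (Real.exp (u / 2) - Real.exp (v / 2))

theorem q_mul_q_le_sq (a t r : ℝ) : q a t * q a r ≤ q a ((t + r) / 2) ^ 2 := by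
  have hmid : (t + r) / 2 - a = ((t - a) + (r - a)) / 2 := by ring
  rw [q, q, q, div_mul_div_comm, ← sq, div_pow, hmid]
  gcongr
  exact one_sub_exp_mul_le_sq _ _

theorem sSup_union_of_nonneg {A B : Set ℝ} (hA : BddAbove A) (hB : BddAbove B)
    (hA₀ : ∀ r ∈ A, 0 ≤ r) (hB₀ : ∀ r ∈ B, 0 ≤ r) : sSup (A ∪ B) = max (sSup A) (sSup B) := by
  rcases A.eq_empty_or_nonempty with rfl | hA'
  · simpa using Real.sSup_nonneg hB₀
  rcases B.eq_empty_or_nonempty with rfl | hB'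
  · simpa using Real.sSup_nonneg hA₀
  exact csSup_union hA hA' hB hB'

theorem sSup_image_Icc_eq_max {F G H : ℝ → ℝ} {l m u : ℝ} (hm : m ∈ Set.Icc l u)
    (hF : BddAbove (F '' Set.Icc l u)) (hF₀ : ∀ r ∈ Set.Icc l u, 0 ≤ F r)
    (hG : Set.EqOn F G (Set.Ico l m)) (hH : Set.EqOn F H (Set.Icc m u)) :
    sSup (F '' Set.Icc l u) = max (sSup (G '' Set.Ico l m)) (sSup (H '' Set.Icc m u)) := by
  rw [← hG.image_eq, ← hH.image_eq]
  rw [← Set.Ico_union_Icc_eq_Icc hm.1 hm.2] at hF hF₀ ⊢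
  rw [Set.image_union] at hF ⊢
  exact sSup_union_of_nonneg (hF.mono Set.subset_union_left) (hF.mono Set.subset_union_right)
    (Set.forall_mem_image.2 fun r hr => hF₀ r (.inl hr))
    (Set.forall_mem_image.2 fun r hr => hF₀ r (.inr hr))

theorem sSup_image_mul {α : Type*} (hc : 0 ≤ c) (F : α → ℝ) (A : Set α) :
    sSup ((fun x => c * F x) '' A) = c * sSup (F '' A) := by
  rw [← smul_eq_mul, ← Real.sSup_smul_of_nonneg hc, ← Set.image_smul, Set.image_image]
  rfl

end Real

section PrivacyLoss

variable {Y : Type*} [MeasurableSpace Y] {P Q : Measure Y} {l u : ℝ}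

/-- The privacy loss `log (dP/dQ)` lies in `[l, u]`, that is `e^l Q ≤ P ≤ e^u Q`. Both inequalities
are solved for the smaller measure, so that exchanging `P` and `Q` replaces `[l, u]` by
`[-u, -l]`. -/
def LossIn (l u : ℝ) (P Q : Measure Y) : Prop :=
  ∀ S, MeasurableSet S →
    P.real S ≤ Real.exp u * Q.real S ∧ Q.real S ≤ Real.exp (-l) * P.real S

theorem LossIn.symm (h : LossIn l u P Q) : LossIn (-u) (-l) Q P := fun S hS =>
  ⟨(h S hS).2, by simpa using (h S hS).1⟩

theorem LossIn.refl (P : Measure Y) (hl : l ≤ 0) (hu : 0 ≤ u) : LossIn l u P P := fun _ _ =>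
  ⟨le_mul_of_one_le_left measureReal_nonneg (Real.one_le_exp hu),
    le_mul_of_one_le_left measureReal_nonneg (Real.one_le_exp (neg_nonneg.2 hl))⟩

theorem LossIn.real_mul_real_le (h : LossIn l u P Q) {S₁ S₂ : Set Y} (hS₁ : MeasurableSet S₁)
    (hS₂ : MeasurableSet S₂) :
    P.real S₁ * Q.real S₂ ≤ Real.exp (u - l) * (P.real S₂ * Q.real S₁) := by
  calc P.real S₁ * Q.real S₂
      ≤ (Real.exp u * Q.real S₁) * (Real.exp (-l) * P.real S₂) :=
        mul_le_mul (h S₁ hS₁).1 (h S₂ hS₂).2 measureReal_nonneg (by positivity)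
    _ = Real.exp (u - l) * (P.real S₂ * Q.real S₁) := by rw [sub_eq_add_neg, Real.exp_add]; ring

section FiniteMeasure

variable [IsFiniteMeasure P] [IsFiniteMeasure Q] {g : Y → ℝ}

theorem LossIn.le_smul (h : LossIn l u P Q) : P ≤ ENNReal.ofReal (Real.exp u) • Q := by
  refine Measure.le_iff.2 fun S hS => ?_
  rw [Measure.smul_apply, smul_eq_mul, ← ofReal_measureReal, ← ofReal_measureReal (μ := Q),
    ← ENNReal.ofReal_mul (Real.exp_pos u).le]
  exact ENNReal.ofReal_le_ofReal (h S hS).1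

theorem LossIn.integrable (h : LossIn l u P Q) (hg : Integrable g Q) : Integrable g P :=
  (hg.smul_measure ENNReal.ofReal_ne_top).mono_measure h.le_smul

theorem LossIn.integral_le (h : LossIn l u P Q) (hg : Integrable g Q) (hg₀ : 0 ≤ g) :
    ∫ y, g y ∂P ≤ Real.exp u * ∫ y, g y ∂Q := by
  have hle := integral_mono_measure h.le_smul (ae_of_all _ hg₀)
    (hg.smul_measure ENNReal.ofReal_ne_top)
  rwa [integral_smul_measure, ENNReal.toReal_ofReal (Real.exp_pos u).le, smul_eq_mul] at hle

end FiniteMeasure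

theorem LossIn.exp_mul_sub_integral_le [IsProbabilityMeasure P] [IsProbabilityMeasure Q]
    (h : LossIn l u P Q) {g : Y → ℝ} {c : ℝ} (hg : Integrable g Q) (hgc : ∀ y, g y ≤ c) :
    Real.exp l * (c - ∫ y, g y ∂Q) ≤ c - ∫ y, g y ∂P := by
  have hP := h.integrable hg
  have hle := h.symm.integral_le ((integrable_const c).sub hP) fun y => sub_nonneg.2 (hgc y)
  simp only [Pi.sub_apply] at hle
  rw [integral_sub (integrable_const c) hP, integral_sub (integrable_const c) hg, integral_const,
    integral_const, probReal_univ, probReal_univ, one_smul, Real.exp_neg] at hle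
  exact (le_inv_mul_iff₀ (Real.exp_pos l)).1 hle

/-- The upper end of the loss interval is the least `t` with `P ≤ e^t Q`. -/
theorem exists_lossIn_of_boundedRange [IsProbabilityMeasure P] [IsProbabilityMeasure Q] {ε : ℝ}
    (h : ∀ S₁ S₂ : Set Y, MeasurableSet S₁ → MeasurableSet S₂ →
      P.real S₁ * Q.real S₂ ≤ Real.exp ε * (P.real S₂ * Q.real S₁)) :
    ∃ t ∈ Set.Icc 0 ε, LossIn (t - ε) t P Q := by
  let B : Set ℝ := {m | ∀ S, MeasurableSet S → P.real S ≤ m * Q.real S}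
  have hB_closed : IsClosed B := by
    simp only [B, Set.ofPred_forall]
    exact isClosed_iInter fun S => isClosed_iInter fun _ =>
      isClosed_le continuous_const (by fun_prop)
  have hB_one : ∀ m ∈ B, 1 ≤ m := fun m hm => by simpa using hm Set.univ .univ
  have hB_exp : Real.exp ε ∈ B := fun S hS => by simpa using h S Set.univ hS .univ
  have hB_bdd : BddBelow B := ⟨1, hB_one⟩
  have hmin : sInf B ∈ B := hB_closed.csInf_mem ⟨_, hB_exp⟩ hB_bdd
  have hpos : 0 < sInf B := zero_lt_one.trans_le (hB_one _ hmin)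
  have hlow (S) (hS : MeasurableSet S) : sInf B * Q.real S ≤ Real.exp ε * P.real S := by
    rcases (measureReal_nonneg (μ := Q) (s := S)).eq_or_lt with hQ | hQ
    · rw [← hQ, mul_zero]; positivity
    · refine (le_div_iff₀ hQ).1 (csInf_le hB_bdd fun S₁ hS₁ => ?_)
      rw [div_mul_eq_mul_div, le_div_iff₀ hQ, mul_assoc]
      exact h S₁ S hS₁ hS
  refine ⟨Real.log (sInf B), ⟨Real.log_nonneg (hB_one _ hmin),
    (Real.log_le_iff_le_exp hpos).2 (csInf_le hB_bdd hB_exp)⟩, fun S hS => ⟨?_, ?_⟩⟩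
  · rw [Real.exp_log hpos]
    exact hmin S hS
  · rw [neg_sub, Real.exp_sub, Real.exp_log hpos, div_mul_eq_mul_div, le_div_iff₀' hpos]
    exact hlow S hS

end PrivacyLoss

section CompProd

variable {Y Z : Type*} [MeasurableSpace Y] [MeasurableSpace Z]

theorem integrable_real_prodMk_preimage (P : Measure Y) [IsFiniteMeasure P] (κ : Kernel Y Z)
    [IsMarkovKernel κ] {S : Set (Y × Z)} (hS : MeasurableSet S) :
    Integrable (fun y => (κ y).real (Prod.mk y ⁻¹' S)) P := by
  have hmeas : Measurable fun y => (κ y).real (Prod.mk y ⁻¹' S) :=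
    (Kernel.measurable_kernel_prodMk_left hS).ennreal_toReal
  refine .of_bound hmeas.aestronglyMeasurable 1 (ae_of_all _ fun y => ?_)
  rw [Real.norm_of_nonneg measureReal_nonneg]
  exact measureReal_le_one

theorem real_compProd (P : Measure Y) [SFinite P] (κ : Kernel Y Z) [IsFiniteKernel κ]
    {S : Set (Y × Z)} (hS : MeasurableSet S) :
    (P ⊗ₘ κ).real S = ∫ y, (κ y).real (Prod.mk y ⁻¹' S) ∂P := by
  rw [measureReal_def, Measure.compProd_apply hS]
  exact (integral_toReal (Kernel.measurable_kernel_prodMk_left hS).aemeasurable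
    (ae_of_all _ fun y => measure_lt_top _ _)).symm

theorem real_compProd_compProd {W : Type*} [MeasurableSpace W] (P : Measure Y) (κ : Kernel Y Z)
    (η : Kernel (Y × Z) W) {S : Set ((Y × Z) × W)} (hS : MeasurableSet S) :
    ((P ⊗ₘ κ) ⊗ₘ η).real S = (P ⊗ₘ (κ ⊗ₖ η)).real (MeasurableEquiv.prodAssoc.symm ⁻¹' S) := by
  rw [← Measure.compProd_assoc, map_measureReal_apply (by fun_prop) hS]

end CompProd

section RandomizedResponse

/-- The optimal `δ` at threshold `s` of a mechanism that ignores its input. -/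
noncomputable def nullProfile (s : ℝ) : ℝ := max 0 (1 - Real.exp s)

theorem nullProfile_of_nonneg {s : ℝ} (hs : 0 ≤ s) : nullProfile s = 0 :=
  max_eq_left (sub_nonpos.2 (Real.one_le_exp hs))

theorem nullProfile_of_nonpos {s : ℝ} (hs : s ≤ 0) : nullProfile s = 1 - Real.exp s :=
  max_eq_right (sub_nonneg.2 (Real.exp_le_one_iff.2 hs))

theorem nullProfile_nonneg : 0 ≤ nullProfile := fun _ => le_max_left _ _

@[fun_prop]
theorem continuous_nullProfile : Continuous nullProfile := by
  unfold nullProfile; fun_prop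

theorem indicator_sub_exp_mul_le_nullProfile {Y : Type*} (S : Set Y) (y : Y) (s : ℝ) :
    S.indicator 1 y - Real.exp s * S.indicator 1 y ≤ nullProfile s := by
  by_cases hy : y ∈ S <;> simp [hy, nullProfile]

/-- The probability of each answer of generalized randomized response on input `true`. The inputs
and answers `true`, `false` are the paper's `0`, `1`. -/
noncomputable def grrWeight (a t : ℝ) : Bool → ℝ
  | true => q a t
  | false => 1 - q a t

/-- The privacy loss of each answer of generalized randomized response, for the input `true`
against the input `false`. -/
def grrLoss (a t : ℝ) : Bool → ℝ
  | true => t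
  | false => t - a

/-- The probability that generalized randomized response answers `b` to the input `x`. -/
noncomputable def grrProb (a t : ℝ) (x b : Bool) : ℝ :=
  match x with
  | true => grrWeight a t b
  | false => Real.exp (-grrLoss a t b) * grrWeight a t b

/-- Generalized randomized response: the mechanism with one-bit input and output whose two privacy
losses are `t` and `t - a`. -/
noncomputable def grr (a t : ℝ) (x : Bool) : Measure Bool :=
  ∑ b, ENNReal.ofReal (grrProb a t x b) • Measure.dirac b

/-- The profile, as a function of the threshold `s`, of generalized randomized response followed by
a mechanism with profile `f`: after the answer `b` the remaining threshold is
`s - grrLoss a t b`. -/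
noncomputable def grrComp (a t : ℝ) (f : ℝ → ℝ) (s : ℝ) : ℝ :=
  ∑ b, grrWeight a t b * f (s - grrLoss a t b)

variable {a t : ℝ}

theorem grrWeight_nonneg (ha : 0 < a) (ht : t ∈ Set.Icc 0 a) (b : Bool) :
    0 ≤ grrWeight a t b := by
  cases b
  exacts [sub_nonneg.2 (q_mem_Icc ha ht).2, (q_mem_Icc ha ht).1]

theorem grrLoss_mem_Icc (ha : 0 ≤ a) (t : ℝ) (b : Bool) :
    grrLoss a t b ∈ Set.Icc (t - a) t := by
  cases b <;> simp [grrLoss, ha]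

theorem grrComp_apply (a t : ℝ) (f : ℝ → ℝ) (s : ℝ) :
    grrComp a t f s = q a t * f (s - t) + (1 - q a t) * f (s - t + a) := by
  rw [grrComp, Fintype.sum_bool, grrLoss, grrLoss, sub_sub_eq_add_sub, add_sub_right_comm,
    grrWeight, grrWeight]

theorem grrComp_one_sub_exp (ha : 0 < a) (t s : ℝ) :
    grrComp a t (fun r => 1 - Real.exp r) s = 1 - Real.exp s := by
  have hq := q_mul_one_sub_exp_neg ha t
  have hlow : Real.exp (s - t) = Real.exp (s - t + a) * Real.exp (-a) := by
    rw [← Real.exp_add]; ring_nf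
  have hmid : Real.exp (s - t + a) * Real.exp (t - a) = Real.exp s := by
    rw [← Real.exp_add]; ring_nf
  rw [grrComp_apply, hlow]
  linear_combination Real.exp (s - t + a) * hq - hmid

theorem grrProb_nonneg (ha : 0 < a) (ht : t ∈ Set.Icc 0 a) (x b : Bool) :
    0 ≤ grrProb a t x b := by
  have hw := grrWeight_nonneg ha ht b
  cases x
  exacts [mul_nonneg (Real.exp_pos _).le hw, hw]

theorem sum_grrProb (ha : 0 < a) (t : ℝ) (x : Bool) : ∑ b, grrProb a t x b = 1 := by
  cases x
  · have h := grrComp_one_sub_exp ha t 0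
    simp only [grrComp, Fintype.sum_bool, grrWeight, zero_sub, Real.exp_zero] at h
    simp only [grrProb, Fintype.sum_bool, grrWeight]
    linear_combination -h
  · simp [grrProb, grrWeight]

theorem isProbabilityMeasure_grr (ha : 0 < a) (ht : t ∈ Set.Icc 0 a) (x : Bool) :
    IsProbabilityMeasure (grr a t x) := by
  refine ⟨?_⟩
  simp only [grr, Measure.finsetSum_apply, Measure.smul_apply, measure_univ, smul_eq_mul, mul_one]
  rw [← ENNReal.ofReal_sum_of_nonneg fun b _ => grrProb_nonneg ha ht x b, sum_grrProb ha,
    ENNReal.ofReal_one]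

theorem integral_grr (ha : 0 < a) (ht : t ∈ Set.Icc 0 a) (x : Bool) (h : Bool → ℝ) :
    ∫ b, h b ∂(grr a t x) = ∑ b, grrProb a t x b * h b := by
  rw [grr, integral_finsetSum_measure fun b _ =>
    (integrable_dirac (by simp)).smul_measure ENNReal.ofReal_ne_top]
  refine Finset.sum_congr rfl fun b _ => ?_
  rw [integral_smul_measure, integral_dirac, ENNReal.toReal_ofReal (grrProb_nonneg ha ht x b),
    smul_eq_mul]

theorem lossIn_grr (ha : 0 < a) (ht : t ∈ Set.Icc 0 a) :
    LossIn (t - a) t (grr a t true) (grr a t false) := by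
  intro S hS
  have hloss := grrLoss_mem_Icc ha.le t
  have hterm (b : Bool) : 0 ≤ grrWeight a t b * S.indicator 1 b :=
    mul_nonneg (grrWeight_nonneg ha ht b) (Set.indicator_nonneg (by simp) b)
  simp only [← integral_indicator_one hS, integral_grr ha ht, grrProb, Finset.mul_sum, mul_assoc]
  refine ⟨Finset.sum_le_sum fun b _ => ?_, Finset.sum_le_sum fun b _ => ?_⟩
  · rw [← mul_assoc, ← Real.exp_add, ← sub_eq_add_neg]
    exact le_mul_of_one_le_left (hterm b) (Real.one_le_exp (sub_nonneg.2 (hloss b).2))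
  · exact mul_le_mul_of_nonneg_right (Real.exp_le_exp.2 (neg_le_neg (hloss b).1)) (hterm b)

theorem grrComp_le_integral_grr_sub (ha : 0 < a) (ht : t ∈ Set.Icc 0 a) {f : ℝ → ℝ} {s : ℝ}
    {h h' : Bool → ℝ}
    (hf : ∀ b, f (s - grrLoss a t b) ≤ h b - Real.exp (s - grrLoss a t b) * h' b) :
    grrComp a t f s ≤ ∫ b, h b ∂(grr a t true) - Real.exp s * ∫ b, h' b ∂(grr a t false) := by
  rw [integral_grr ha ht, integral_grr ha ht, Finset.mul_sum, ← Finset.sum_sub_distrib]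
  refine Finset.sum_le_sum fun b _ => ?_
  calc grrWeight a t b * f (s - grrLoss a t b)
      ≤ grrWeight a t b * (h b - Real.exp (s - grrLoss a t b) * h' b) :=
        mul_le_mul_of_nonneg_left (hf b) (grrWeight_nonneg ha ht b)
    _ = _ := by rw [sub_eq_add_neg s, Real.exp_add, grrProb, grrProb]; ring

theorem LossIn.integral_sub_le_grrComp {Y : Type*} [MeasurableSpace Y] {P Q : Measure Y}
    [IsProbabilityMeasure P] [IsProbabilityMeasure Q] (hPQ : LossIn (t - a) t P Q) (ha : 0 < a)
    {h h' : Y → ℝ} (hh : Integrable h Q) (hh' : Integrable h' Q) {f : ℝ → ℝ}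
    (hf : ∀ y s, h y - Real.exp s * h' y ≤ f s) (s : ℝ) :
    ∫ y, h y ∂P - Real.exp s * ∫ y, h' y ∂Q ≤ grrComp a t f s := by
  have hhP' := hPQ.integrable hh'
  have hhP := hPQ.integrable hh
  -- `(1 - e⁻ᵃ) (h P - eˢ h' Q)` is `(h - eˢ⁻ᵗ h') (P - eᵗ⁻ᵃ Q) + e⁻ᵃ (h - eˢ⁻ᵗ⁺ᵃ h') (eᵗ Q - P)`,
  -- where both measures are nonnegative; the next two facts integrate these summands.
  have htrue := hPQ.exp_mul_sub_integral_le (hh.sub (hh'.const_mul (Real.exp (s - t))))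
    (fun y => hf y (s - t))
  have hfalse := hPQ.symm.exp_mul_sub_integral_le (hhP.sub (hhP'.const_mul (Real.exp (s - t + a))))
    (fun y => hf y (s - t + a))
  simp only [Pi.sub_apply] at htrue hfalse
  rw [integral_sub hh (hh'.const_mul _), integral_sub hhP (hhP'.const_mul _), integral_const_mul,
    integral_const_mul] at htrue hfalse
  have hexp₁ : Real.exp (t - a) * Real.exp (s - t) = Real.exp (-a) * Real.exp s := by
    rw [← Real.exp_add, ← Real.exp_add]; ring_nf
  have hexp₂ : Real.exp (t - a) * Real.exp (s - t + a) = Real.exp s := by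
    rw [← Real.exp_add]; ring_nf
  have hexp₃ : Real.exp (t - a) * Real.exp (-t) = Real.exp (-a) := by
    rw [← Real.exp_add]; ring_nf
  have hexp₄ : Real.exp (-a) * Real.exp (s - t + a) = Real.exp (s - t) := by
    rw [← Real.exp_add]; ring_nf
  have hq := q_mul_one_sub_exp_neg ha t
  refine le_of_mul_le_mul_right ?_ (one_sub_exp_neg_pos ha)
  rw [grrComp_apply]
  have hfalse' := mul_le_mul_of_nonneg_left hfalse (Real.exp_pos (t - a)).le
  linear_combination htrue + hfalse' + (∫ y, h' y ∂Q) * (hexp₂ - hexp₁)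
    - (f (s - t + a) - (∫ y, h y ∂P - Real.exp (s - t + a) * ∫ y, h' y ∂P)) * hexp₃
    - (∫ y, h' y ∂P) * hexp₄ - (f (s - t) - f (s - t + a)) * hq

theorem grrComp_nonneg (ha : 0 < a) (ht : t ∈ Set.Icc 0 a) {f : ℝ → ℝ} (hf : 0 ≤ f) (s : ℝ) :
    0 ≤ grrComp a t f s :=
  Finset.sum_nonneg fun b _ => mul_nonneg (grrWeight_nonneg ha ht b) (hf _)

@[fun_prop]
theorem continuous_grrComp {α : Type*} [TopologicalSpace α] {f : ℝ → ℝ} (hf : Continuous f)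
    (a : ℝ) {t s : α → ℝ} (ht : Continuous t) (hs : Continuous s) :
    Continuous fun x => grrComp a (t x) f (s x) := by
  simp only [grrComp_apply]
  fun_prop

end RandomizedResponse

section ClassComp

/-- The pointwise largest of the profiles `grrComp a t f` with `t` in `T`. -/
noncomputable def classComp (a : ℝ) (T : Set ℝ) (f : ℝ → ℝ) (s : ℝ) : ℝ :=
  sSup ((fun t => grrComp a t f s) '' T)

variable {a : ℝ} {T : Set ℝ} {f : ℝ → ℝ}

theorem classComp_singleton (a t : ℝ) (f : ℝ → ℝ) : classComp a {t} f = grrComp a t f := by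
  funext s
  rw [classComp, Set.image_singleton, csSup_singleton]

theorem classComp_nonneg (ha : 0 < a) (hT : T ⊆ Set.Icc 0 a) (hf : 0 ≤ f) : 0 ≤ classComp a T f :=
  fun s => Real.sSup_nonneg <| Set.forall_mem_image.2 fun _ ht => grrComp_nonneg ha (hT ht) hf s

theorem bddAbove_grrComp_image (hT : IsCompact T) (hf : Continuous f) (a s : ℝ) :
    BddAbove ((fun t => grrComp a t f s) '' T) :=
  hT.bddAbove_image (by fun_prop)

theorem grrComp_le_classComp (hT : IsCompact T) (hf : Continuous f) {t : ℝ} (ht : t ∈ T)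
    (a s : ℝ) : grrComp a t f s ≤ classComp a T f s :=
  le_csSup (bddAbove_grrComp_image hT hf a s) (Set.mem_image_of_mem _ ht)

theorem exists_classComp_eq_grrComp (hT : IsCompact T) (hT₀ : T.Nonempty) (hf : Continuous f)
    (a s : ℝ) : ∃ t ∈ T, classComp a T f s = grrComp a t f s :=
  hT.exists_sSup_image_eq hT₀ (by fun_prop)

@[fun_prop]
theorem continuous_classComp (hT : IsCompact T) (hf : Continuous f) (a : ℝ) :
    Continuous (classComp a T f) :=
  hT.continuous_sSup (by fun_prop)

end ClassComp

section DeltaOpt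

variable {X : Type*} {Adj : X → X → Prop} {Y : Type} [MeasurableSpace Y] {M : X → Measure Y}

theorem deltaOptMech_le {s δ : ℝ} (hδ : 0 ≤ δ) (hM : IsDP Adj M s δ) : deltaOptMech Adj M s ≤ δ :=
  csInf_le ⟨0, fun _ h => h.1⟩ ⟨hδ, hM⟩

theorem le_deltaOptMech [∀ x, IsProbabilityMeasure (M x)] {x x' : X} (hadj : Adj x x') {S : Set Y}
    (hS : MeasurableSet S) (s : ℝ) :
    (M x).real S - Real.exp s * (M x').real S ≤ deltaOptMech Adj M s := by
  refine le_csInf ⟨1, zero_le_one, fun x x' _ S _ => ?_⟩ fun δ hδ => ?_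
  · exact measureReal_le_one.trans (le_add_of_nonneg_left (by positivity))
  · exact sub_le_iff_le_add'.2 (hδ.2 x x' hadj S hS)

end DeltaOpt

section GRRClass

variable {X : Type*} {Adj : X → X → Prop}

/-- The generalized randomized responses with losses `t` and `t - a`, `t ∈ T`, belong to the class
`C`, and every mechanism of `C` has, for any two neighbouring datasets, its privacy loss between
the two losses of one of them. The randomized responses are fed an arbitrary bit `side x` of the
dataset `x`. -/
structure IsGRRClass (Adj : X → X → Prop) (C : MechClass X) (a : ℝ) (T : Set ℝ) : Prop where
  width_pos : 0 < a
  subset : T ⊆ Set.Icc 0 a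
  nonempty : T.Nonempty
  isCompact : IsCompact T
  isProbabilityMeasure : ∀ {Y : Type} [MeasurableSpace Y] {M : X → Measure Y}, C Y M →
    ∀ x, IsProbabilityMeasure (M x)
  exists_lossIn : ∀ {Y : Type} [MeasurableSpace Y] {M : X → Measure Y}, C Y M →
    ∀ {x x'}, Adj x x' → ∃ t ∈ T, LossIn (t - a) t (M x) (M x')
  grr_mem : ∀ {t}, t ∈ T → ∀ side : X → Bool, C Bool fun x => grr a t (side x)

variable {C C₁ C₂ C₃ : MechClass X} {a a₁ a₂ a₃ : ℝ} {T T₁ T₂ T₃ : Set ℝ} {f : ℝ → ℝ}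

section Upper

variable {Y Z : Type} [MeasurableSpace Y] [MeasurableSpace Z] {M : X → Measure Y}

theorem IsGRRClass.integral_sub_le (hC : IsGRRClass Adj C a T) (hM : C Y M) {x x' : X}
    (hadj : Adj x x') {h h' : Y → ℝ} (hh : Integrable h (M x')) (hh' : Integrable h' (M x'))
    (hfc : Continuous f) (hf : ∀ y s, h y - Real.exp s * h' y ≤ f s) (s : ℝ) :
    ∫ y, h y ∂(M x) - Real.exp s * ∫ y, h' y ∂(M x') ≤ classComp a T f s := by
  have := hC.isProbabilityMeasure hM
  obtain ⟨t, ht, hloss⟩ := hC.exists_lossIn hM hadj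
  exact (hloss.integral_sub_le_grrComp hC.width_pos hh hh' hf s).trans
    (grrComp_le_classComp hC.isCompact hfc ht a s)

theorem IsGRRClass.isDP (hC : IsGRRClass Adj C a T) (hM : C Y M) (s : ℝ) :
    IsDP Adj M s (classComp a T nullProfile s) := by
  intro x x' hadj S hS
  have := hC.isProbabilityMeasure hM
  have hint : Integrable (S.indicator (1 : Y → ℝ)) (M x') := (integrable_const 1).indicator hS
  have hle := hC.integral_sub_le hM hadj hint hint continuous_nullProfile
    (indicator_sub_exp_mul_le_nullProfile S) s
  rw [integral_indicator_one hS, integral_indicator_one hS] at hle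
  exact sub_le_iff_le_add'.1 hle

theorem IsGRRClass.isDP_compProd (hC : IsGRRClass Adj C a T) (hM : C Y M) {κ : X → Kernel Y Z}
    [∀ x, IsMarkovKernel (κ x)] (hfc : Continuous f)
    (hκ : ∀ y s, IsDP Adj (fun x => κ x y) s (f s)) (s : ℝ) :
    IsDP Adj (fun x => M x ⊗ₘ κ x) s (classComp a T f s) := by
  intro x x' hadj S hS
  have := hC.isProbabilityMeasure hM
  rw [real_compProd _ _ hS, real_compProd _ _ hS, ← sub_le_iff_le_add']
  exact hC.integral_sub_le hM hadj (integrable_real_prodMk_preimage _ _ hS)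
    (integrable_real_prodMk_preimage _ _ hS) hfc
    (fun y s => sub_le_iff_le_add'.2 (hκ y s x x' hadj _ (measurable_prodMk_left hS))) s

theorem isDP_of_adaptive (h₁ : IsGRRClass Adj C₁ a₁ T₁) (h₂ : IsGRRClass Adj C₂ a₂ T₂)
    (h₃ : IsGRRClass Adj C₃ a₃ T₃) (hM : Adaptive C₁ C₂ C₃ Y M) (s : ℝ) :
    IsDP Adj M s (classComp a₁ T₁ (classComp a₂ T₂ (classComp a₃ T₃ nullProfile)) s) := by
  obtain ⟨M₁, M₂, M₃, hM₁, hM₂, hM₃⟩ := hM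
  have := h₁.isProbabilityMeasure hM₁
  have hprob₂ (x) : IsMarkovKernel (M₂ x) := ⟨fun y => h₂.isProbabilityMeasure (hM₂ y) x⟩
  have hprob₃ (x) : IsMarkovKernel (M₃ x) := ⟨fun y => h₃.isProbabilityMeasure (hM₃ y) x⟩
  have hcont₃ := continuous_classComp h₃.isCompact continuous_nullProfile a₃
  have hlast₂ (y₁ s) : IsDP Adj (fun x => (M₂ x ⊗ₖ M₃ x) y₁) s
      (classComp a₂ T₂ (classComp a₃ T₃ nullProfile) s) := by
    simp only [Kernel.compProd_apply_eq_compProd_sectR]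
    exact h₂.isDP_compProd (hM₂ y₁) hcont₃ (fun y₂ s => h₃.isDP (hM₃ (y₁, y₂)) s) s
  intro x x' hadj S hS
  rw [real_compProd_compProd _ _ _ hS, real_compProd_compProd _ _ _ hS]
  exact h₁.isDP_compProd hM₁ (continuous_classComp h₂.isCompact hcont₃ a₂) hlast₂ s x x' hadj _
    (MeasurableEquiv.measurable _ hS)

end Upper

section Lower

theorem grrComp_le_real_compProd_sub {t s : ℝ} (ha : 0 < a) (ht : t ∈ Set.Icc 0 a) {Y : Type*}
    [MeasurableSpace Y] {κ κ' : Kernel Bool Y} [IsFiniteKernel κ] [IsFiniteKernel κ']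
    {S : Set (Bool × Y)} (hS : MeasurableSet S)
    (hf : ∀ b, f (s - grrLoss a t b) ≤ (κ b).real (Prod.mk b ⁻¹' S) -
      Real.exp (s - grrLoss a t b) * (κ' b).real (Prod.mk b ⁻¹' S)) :
    grrComp a t f s ≤ (grr a t true ⊗ₘ κ).real S - Real.exp s * (grr a t false ⊗ₘ κ').real S := by
  have := isProbabilityMeasure_grr ha ht
  rw [real_compProd _ _ hS, real_compProd _ _ hS]
  exact grrComp_le_integral_grr_sub ha ht hf

theorem grrComp_nullProfile_le_real_sub {t : ℝ} (ha : 0 < a) (ht : t ∈ Set.Icc 0 a) (s : ℝ) :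
    grrComp a t nullProfile s ≤ (grr a t true).real {b | s - grrLoss a t b < 0} -
      Real.exp s * (grr a t false).real {b | s - grrLoss a t b < 0} := by
  rw [← integral_indicator_one (Set.toFinite _).measurableSet,
    ← integral_indicator_one (Set.toFinite _).measurableSet]
  refine grrComp_le_integral_grr_sub ha ht fun b => ?_
  rcases lt_or_ge (s - grrLoss a t b) 0 with hb | hb
  · simp [Set.indicator, nullProfile_of_nonpos hb.le, sub_neg.1 hb]
  · simp [Set.indicator, nullProfile_of_nonneg hb, (sub_nonneg.1 hb).not_gt]

/-- Generalized randomized response whose first privacy loss is chosen after seeing an earlier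
outcome. -/
noncomputable def grrKernel {Y : Type*} [MeasurableSpace Y] [Countable Y]
    [MeasurableSingletonClass Y] (a : ℝ) (t : Y → ℝ) (x : Bool) : Kernel Y Bool :=
  Kernel.ofFunOfCountable fun y => grr a (t y) x

theorem isMarkovKernel_grrKernel {Y : Type*} [MeasurableSpace Y] [Countable Y]
    [MeasurableSingletonClass Y] (ha : 0 < a) {t : Y → ℝ} (ht : ∀ y, t y ∈ Set.Icc 0 a)
    (x : Bool) : IsMarkovKernel (grrKernel a t x) :=
  ⟨fun y => isProbabilityMeasure_grr ha (ht y) x⟩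

theorem exists_grrComp_le_real_compProd_compProd_sub {t₁ s : ℝ} {t₂ : Bool → ℝ}
    {t₃ : Bool × Bool → ℝ} {f₂ f₃ : ℝ → ℝ} (ha₁ : 0 < a₁) (ha₂ : 0 < a₂) (ha₃ : 0 < a₃)
    (ht₁ : t₁ ∈ Set.Icc 0 a₁) (ht₂ : ∀ b, t₂ b ∈ Set.Icc 0 a₂) (ht₃ : ∀ b, t₃ b ∈ Set.Icc 0 a₃)
    (hf₂ : ∀ b, f₂ (s - grrLoss a₁ t₁ b) ≤ grrComp a₂ (t₂ b) f₃ (s - grrLoss a₁ t₁ b))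
    (hf₃ : ∀ b b', f₃ (s - grrLoss a₁ t₁ b - grrLoss a₂ (t₂ b) b') ≤
      grrComp a₃ (t₃ (b, b')) nullProfile (s - grrLoss a₁ t₁ b - grrLoss a₂ (t₂ b) b')) :
    ∃ S, MeasurableSet S ∧ grrComp a₁ t₁ f₂ s ≤
      ((grr a₁ t₁ true ⊗ₘ grrKernel a₂ t₂ true) ⊗ₘ grrKernel a₃ t₃ true).real S -
        Real.exp s *
          ((grr a₁ t₁ false ⊗ₘ grrKernel a₂ t₂ false) ⊗ₘ grrKernel a₃ t₃ false).real S := by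
  have hmarkov₂ := isMarkovKernel_grrKernel ha₂ ht₂
  have hmarkov₃ := isMarkovKernel_grrKernel ha₃ ht₃
  let S : Set ((Bool × Bool) × Bool) :=
    {b | s - grrLoss a₁ t₁ b.1.1 - grrLoss a₂ (t₂ b.1.1) b.1.2 - grrLoss a₃ (t₃ b.1) b.2 < 0}
  have hS : MeasurableSet S := S.toFinite.measurableSet
  refine ⟨S, hS, ?_⟩
  rw [real_compProd_compProd _ _ _ hS, real_compProd_compProd _ _ _ hS]
  refine grrComp_le_real_compProd_sub ha₁ ht₁ (MeasurableEquiv.measurable _ hS) fun b₁ =>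
    (hf₂ b₁).trans ?_
  rw [Kernel.compProd_apply_eq_compProd_sectR, Kernel.compProd_apply_eq_compProd_sectR]
  exact grrComp_le_real_compProd_sub ha₂ (ht₂ b₁) (Set.toFinite _).measurableSet fun b₂ =>
    (hf₃ b₁ b₂).trans (grrComp_nullProfile_le_real_sub ha₃ (ht₃ (b₁, b₂)) _)

theorem exists_adaptive_le_deltaOptMech (h₁ : IsGRRClass Adj C₁ a₁ T₁)
    (h₂ : IsGRRClass Adj C₂ a₂ T₂) (h₃ : IsGRRClass Adj C₃ a₃ T₃)
    (hne : ∃ x x', x ≠ x' ∧ Adj x x') (s : ℝ) :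
    ∃ (Y : Type) (_ : MeasurableSpace Y) (M : X → Measure Y), Adaptive C₁ C₂ C₃ Y M ∧
      classComp a₁ T₁ (classComp a₂ T₂ (classComp a₃ T₃ nullProfile)) s
        ≤ deltaOptMech Adj M s := by
  classical
  obtain ⟨x₀, x₁, hx, hadj⟩ := hne
  have hcont₃ := continuous_classComp h₃.isCompact continuous_nullProfile a₃
  have hcont₂ := continuous_classComp h₂.isCompact hcont₃ a₂
  obtain ⟨t₁, ht₁, heq₁⟩ := exists_classComp_eq_grrComp h₁.isCompact h₁.nonempty hcont₂ a₁ s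
  choose t₂ ht₂ heq₂ using exists_classComp_eq_grrComp h₂.isCompact h₂.nonempty hcont₃ a₂
  choose t₃ ht₃ heq₃ using
    exists_classComp_eq_grrComp h₃.isCompact h₃.nonempty continuous_nullProfile a₃
  let s₂ (b : Bool) : ℝ := s - grrLoss a₁ t₁ b
  let s₃ (b : Bool × Bool) : ℝ := s₂ b.1 - grrLoss a₂ (t₂ (s₂ b.1)) b.2
  obtain ⟨S, hS, hle⟩ := exists_grrComp_le_real_compProd_compProd_sub h₁.width_pos h₂.width_pos
    h₃.width_pos (h₁.subset ht₁) (fun b => h₂.subset (ht₂ (s₂ b)))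
    (fun b => h₃.subset (ht₃ (s₃ b))) (fun b => (heq₂ (s₂ b)).le)
    fun b b' => (heq₃ (s₃ (b, b'))).le
  let side (x : X) : Bool := decide (x = x₀)
  let M (x : X) : Measure ((Bool × Bool) × Bool) := (grr a₁ t₁ (side x) ⊗ₘ
    grrKernel a₂ (fun b => t₂ (s₂ b)) (side x)) ⊗ₘ grrKernel a₃ (fun b => t₃ (s₃ b)) (side x)
  have hM : Adaptive C₁ C₂ C₃ _ M := .mk (fun x => grr a₁ t₁ (side x)) _ _ (h₁.grr_mem ht₁ side)
      (fun _ => h₂.grr_mem (ht₂ _) side) fun _ => h₃.grr_mem (ht₃ _) side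
  have hprob₁ := isProbabilityMeasure_grr h₁.width_pos (h₁.subset ht₁)
  have hprob₂ := isMarkovKernel_grrKernel h₂.width_pos fun b => h₂.subset (ht₂ (s₂ b))
  have hprob₃ := isMarkovKernel_grrKernel h₃.width_pos fun b => h₃.subset (ht₃ (s₃ b))
  have hprob (x) : IsProbabilityMeasure (M x) := inferInstanceAs (IsProbabilityMeasure (_ ⊗ₘ _))
  refine ⟨_, _, M, hM, heq₁.trans_le (hle.trans ?_)⟩
  simpa [M, side, hx.symm] using le_deltaOptMech (M := M) hadj hS s

end Lower

theorem deltaOpt_adaptive (h₁ : IsGRRClass Adj C₁ a₁ T₁) (h₂ : IsGRRClass Adj C₂ a₂ T₂)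
    (h₃ : IsGRRClass Adj C₃ a₃ T₃) (hne : ∃ x x', x ≠ x' ∧ Adj x x') (s : ℝ) :
    deltaOpt Adj (Adaptive C₁ C₂ C₃) s
      = classComp a₁ T₁ (classComp a₂ T₂ (classComp a₃ T₃ nullProfile)) s := by
  have hnonneg := classComp_nonneg h₁.width_pos h₁.subset (classComp_nonneg h₂.width_pos h₂.subset
    (classComp_nonneg h₃.width_pos h₃.subset nullProfile_nonneg)) s
  have hle : ∀ d ∈ {d | ∃ (Y : Type) (_ : MeasurableSpace Y) (M : X → Measure Y),
      Adaptive C₁ C₂ C₃ Y M ∧ d = deltaOptMech Adj M s},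
      d ≤ classComp a₁ T₁ (classComp a₂ T₂ (classComp a₃ T₃ nullProfile)) s := by
    rintro d ⟨Y, _, M, hM, rfl⟩
    exact deltaOptMech_le hnonneg (isDP_of_adaptive h₁ h₂ h₃ hM s)
  obtain ⟨Y, _, M, hM, hge⟩ := exists_adaptive_le_deltaOptMech h₁ h₂ h₃ hne s
  exact le_antisymm (Real.sSup_le hle hnonneg)
    (hge.trans (le_csSup ⟨_, hle⟩ ⟨Y, _, M, hM, rfl⟩))

theorem lossIn_grr_of_bits {t : ℝ} (ha : 0 < a) (ht : t ∈ Set.Icc 0 a) (x x' : Bool) :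
    LossIn (t - a) t (grr a t x) (grr a t x') ∨ LossIn (-t) (a - t) (grr a t x) (grr a t x') := by
  have hloss := lossIn_grr ha ht
  cases x <;> cases x'
  · exact .inl (.refl _ (sub_nonpos.2 ht.2) ht.1)
  · exact .inr (by simpa using hloss.symm)
  · exact .inl hloss
  · exact .inl (.refl _ (sub_nonpos.2 ht.2) ht.1)

theorem isGRRClass_DP (hsymm : ∀ x x', Adj x x' → Adj x' x) {ε : ℝ} (hε : 0 < ε) :
    IsGRRClass Adj (DP Adj ε) (2 * ε) {ε} where
  width_pos := by positivity
  subset := Set.singleton_subset_iff.2 ⟨hε.le, by linarith⟩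
  nonempty := Set.singleton_nonempty ε
  isCompact := isCompact_singleton
  isProbabilityMeasure h := h.1
  exists_lossIn {_ _ M} h x x' hadj := by
    refine ⟨ε, rfl, fun S hS => ⟨by simpa using h.2 x x' hadj S hS, ?_⟩⟩
    convert h.2 x' x (hsymm x x' hadj) S hS using 1
    ring_nf
  grr_mem {t} ht side := by
    obtain rfl : t = ε := ht
    have hε' : t ∈ Set.Icc 0 (2 * t) := ⟨hε.le, by linarith⟩
    have h2ε : 0 < 2 * t := by positivity
    refine ⟨fun x => isProbabilityMeasure_grr h2ε hε' _, fun x x' _ S hS => ?_⟩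
    rw [add_zero]
    rcases lossIn_grr_of_bits h2ε hε' (side x) (side x') with h | h
    · exact (h S hS).1
    · simpa [two_mul] using (h S hS).1

theorem isGRRClass_BR {ε : ℝ} (hε : 0 < ε) :
    IsGRRClass Adj (BR Adj ε) ε (Set.Icc 0 ε) where
  width_pos := hε
  subset := subset_rfl
  nonempty := Set.nonempty_Icc.2 hε.le
  isCompact := isCompact_Icc
  isProbabilityMeasure h := h.1
  exists_lossIn h x x' hadj := by
    have := h.1
    exact exists_lossIn_of_boundedRange (h.2 x x' hadj)
  grr_mem ht side := by
    refine ⟨fun x => isProbabilityMeasure_grr hε ht _, fun x x' _ S₁ S₂ hS₁ hS₂ => ?_⟩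
    rcases lossIn_grr_of_bits hε ht (side x) (side x') with h | h
    · simpa using h.real_mul_real_le hS₁ hS₂
    · simpa using h.real_mul_real_le hS₁ hS₂

end GRRClass

section Commutation

theorem grrComp_comm (a t b r : ℝ) (f : ℝ → ℝ) :
    grrComp a t (grrComp b r f) = grrComp b r (grrComp a t f) := by
  funext s
  simp only [grrComp, Finset.mul_sum]
  rw [Finset.sum_comm]
  simp only [mul_left_comm, sub_right_comm]

variable {a b r s d : ℝ} {T : Set ℝ} {f : ℝ → ℝ}

theorem classComp_eq_of_forall (hT₀ : T.Nonempty) (h : ∀ t ∈ T, grrComp a t f s = d) :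
    classComp a T f s = d := by
  rw [classComp, Set.image_congr h, hT₀.image_const, csSup_singleton]

theorem classComp_grrComp_le (hT : IsCompact T) (hT₀ : T.Nonempty) (hf : Continuous f) (hb : 0 < b)
    (hr : r ∈ Set.Icc 0 b) (s : ℝ) :
    classComp a T (grrComp b r f) s ≤ grrComp b r (classComp a T f) s := by
  refine csSup_le (hT₀.image _) (Set.forall_mem_image.2 fun t ht => ?_)
  rw [grrComp_comm]
  exact Finset.sum_le_sum fun i _ =>
    mul_le_mul_of_nonneg_left (grrComp_le_classComp hT hf ht a _) (grrWeight_nonneg hb hr i)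

/-- A parameter maximizing the term of the other answer then maximizes both terms. -/
theorem classComp_grrComp_comm_of_const (hT : IsCompact T) (hT₀ : T.Nonempty) (hf : Continuous f)
    (hb : 0 < b) (hr : r ∈ Set.Icc 0 b) {i : Bool}
    (hconst : ∀ t ∈ T, grrComp a t f (s - grrLoss b r i) = d) :
    classComp a T (grrComp b r f) s = grrComp b r (classComp a T f) s := by
  refine le_antisymm (classComp_grrComp_le hT hT₀ hf hb hr s) ?_
  obtain ⟨t, ht, hmax⟩ := exists_classComp_eq_grrComp hT hT₀ hf a (s - grrLoss b r !i)
  have hmax' (j : Bool) :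
      classComp a T f (s - grrLoss b r j) = grrComp a t f (s - grrLoss b r j) := by
    rcases Bool.eq_or_eq_not j i with rfl | rfl
    · rw [classComp_eq_of_forall hT₀ hconst, hconst t ht]
    · exact hmax
  calc grrComp b r (classComp a T f) s
      = grrComp b r (grrComp a t f) s :=
        Finset.sum_congr rfl fun j _ => by rw [hmax']
    _ = grrComp a t (grrComp b r f) s := by rw [grrComp_comm]
    _ ≤ classComp a T (grrComp b r f) s := grrComp_le_classComp hT (by fun_prop) ht a s

end Commutation

section BoundedRangeProfile

variable {ε t s : ℝ}

theorem grrComp_eq_zero {a c : ℝ} {f : ℝ → ℝ} (ha : 0 ≤ a) (hf : ∀ r, c ≤ r → f r = 0)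
    (hs : c + t ≤ s) : grrComp a t f s = 0 := by
  rw [grrComp_apply, hf _ (by linarith), hf _ (by linarith), mul_zero, mul_zero, add_zero]

theorem grrComp_nullProfile_of_le (hε : 0 < ε) (hs : s ≤ t - ε) :
    grrComp ε t nullProfile s = 1 - Real.exp s := by
  rw [← grrComp_one_sub_exp hε t s, grrComp_apply, grrComp_apply,
    nullProfile_of_nonpos (by linarith), nullProfile_of_nonpos (by linarith)]

theorem grrComp_nullProfile_of_mem (hε : 0 < ε) (hs : s ∈ Set.Icc (t - ε) t) :
    grrComp ε t nullProfile s = q ε t * q ε (s - t + ε) * (1 - Real.exp (-ε)) := by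
  rw [grrComp_apply, nullProfile_of_nonpos (sub_nonpos.2 hs.2),
    nullProfile_of_nonneg (by linarith [hs.1]), mul_assoc, q_mul_one_sub_exp_neg hε, mul_zero,
    add_zero, add_sub_cancel_right]

theorem grrComp_nullProfile_le (hε : 0 < ε) (t s : ℝ) :
    grrComp ε t nullProfile s ≤ q ε ((s + ε) / 2) ^ 2 * (1 - Real.exp (-ε)) := by
  have hpos := one_sub_exp_neg_pos hε
  rcases le_total t s with hts | hst
  · rw [grrComp_eq_zero hε.le (fun _ => nullProfile_of_nonneg) (by rwa [zero_add])]
    positivity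
  rcases le_total s (t - ε) with hs | hs
  · calc grrComp ε t nullProfile s
        = q ε 0 * q ε (s + ε) * (1 - Real.exp (-ε)) := by
          rw [grrComp_nullProfile_of_le hε hs, q_zero hε, one_mul, q_mul_one_sub_exp_neg hε,
            add_sub_cancel_right]
      _ ≤ _ := by
          gcongr
          simpa using q_mul_q_le_sq ε 0 (s + ε)
  · have hmid : s + ε = t + (s - t + ε) := by ring
    rw [grrComp_nullProfile_of_mem hε ⟨hs, hst⟩, hmid]
    gcongr
    exact q_mul_q_le_sq ε t (s - t + ε)

/-- The optimal `δ` at threshold `s` over the `ε`-bounded range mechanisms. -/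
noncomputable def brProfile (ε : ℝ) : ℝ → ℝ := classComp ε (Set.Icc 0 ε) nullProfile

theorem brProfile_nonneg (hε : 0 < ε) : 0 ≤ brProfile ε :=
  classComp_nonneg hε subset_rfl nullProfile_nonneg

@[fun_prop]
theorem continuous_brProfile (ε : ℝ) : Continuous (brProfile ε) :=
  continuous_classComp isCompact_Icc continuous_nullProfile ε

theorem brProfile_of_ge (hε : 0 < ε) (hs : ε ≤ s) : brProfile ε s = 0 :=
  classComp_eq_of_forall (Set.nonempty_Icc.2 hε.le) fun _ ht =>
    grrComp_eq_zero hε.le (fun _ => nullProfile_of_nonneg) (by linarith [ht.2])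

theorem brProfile_of_le (hε : 0 < ε) (hs : s ≤ -ε) : brProfile ε s = 1 - Real.exp s :=
  classComp_eq_of_forall (Set.nonempty_Icc.2 hε.le) fun _ ht =>
    grrComp_nullProfile_of_le hε (by linarith [ht.1])

theorem brProfile_of_mem (hε : 0 < ε) (hs : s ∈ Set.Icc (-ε) ε) :
    brProfile ε s = q ε ((s + ε) / 2) ^ 2 * (1 - Real.exp (-ε)) := by
  have hmid : (s + ε) / 2 ∈ Set.Icc 0 ε := ⟨by linarith [hs.1], by linarith [hs.2]⟩
  refine le_antisymm (csSup_le ((Set.nonempty_Icc.2 hε.le).image _)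
    (Set.forall_mem_image.2 fun t _ => grrComp_nullProfile_le hε t s)) ?_
  calc q ε ((s + ε) / 2) ^ 2 * (1 - Real.exp (-ε))
      = grrComp ε ((s + ε) / 2) nullProfile s := by
        rw [grrComp_nullProfile_of_mem hε ⟨by linarith [hs.1], by linarith [hs.2]⟩, sq]
        ring_nf
    _ ≤ brProfile ε s := grrComp_le_classComp isCompact_Icc continuous_nullProfile hmid ε s

theorem grrComp_brProfile_eq_zero (hε : 0 < ε) (hs : ε + t ≤ s) :
    grrComp ε t (brProfile ε) s = 0 :=
  grrComp_eq_zero hε.le (fun _ => brProfile_of_ge hε) hs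

end BoundedRangeProfile

section OptimalDelta

variable {ε εg : ℝ}

theorem classComp_grrComp_nullProfile (hε : 0 < ε) :
    classComp ε (Set.Icc 0 ε) (grrComp (2 * ε) ε nullProfile)
      = grrComp (2 * ε) ε (brProfile ε) := by
  funext s
  have hA : (Set.Icc 0 ε).Nonempty := Set.nonempty_Icc.2 hε.le
  have hmem : ε ∈ Set.Icc 0 (2 * ε) := ⟨hε.le, by linarith⟩
  rcases le_total 0 s with hs | hs
  · refine classComp_grrComp_comm_of_const (i := false) (d := 0) isCompact_Icc hA
      continuous_nullProfile (by positivity) hmem fun t ht => ?_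
    exact grrComp_eq_zero hε.le (fun _ => nullProfile_of_nonneg) (by
      rw [grrLoss]; linarith [ht.2])
  · refine classComp_grrComp_comm_of_const (i := true) (d := 1 - Real.exp (s - ε)) isCompact_Icc hA
      continuous_nullProfile (by positivity) hmem fun t ht => ?_
    exact grrComp_nullProfile_of_le hε (by rw [grrLoss]; linarith [ht.1])

theorem classComp_grrComp_brProfile_of_le (hε : 0 < ε) (hεg : ε ≤ εg) :
    classComp ε (Set.Icc 0 ε) (grrComp (2 * ε) ε (brProfile ε)) εg
      = grrComp (2 * ε) ε (classComp ε (Set.Icc 0 ε) (brProfile ε)) εg :=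
  classComp_grrComp_comm_of_const (i := false) isCompact_Icc (Set.nonempty_Icc.2 hε.le)
    (continuous_brProfile ε) (by positivity) ⟨hε.le, by linarith⟩ fun t ht =>
    grrComp_brProfile_eq_zero hε (by rw [grrLoss]; linarith [ht.2])

theorem eqOn_xFun (hε : 0 < ε) (hεg : εg ≤ ε) :
    Set.EqOn (fun t => q (2 * ε) ε * grrComp ε t (brProfile ε) (εg - ε)) (xFun ε εg)
      (Set.Ico 0 εg) := by
  intro t ht
  dsimp only
  rw [grrComp_apply, brProfile_of_mem hε ⟨by linarith [ht.2], by linarith [ht.1]⟩,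
    brProfile_of_mem hε ⟨by linarith [ht.2], by linarith [ht.1]⟩, xFun]
  ring_nf

theorem eqOn_yFun (hε : 0 < ε) (hεg : 0 ≤ εg) :
    Set.EqOn (fun t => q (2 * ε) ε * grrComp ε t (brProfile ε) (εg - ε)) (yFun ε εg)
      (Set.Icc εg ε) := by
  intro t ht
  dsimp only
  rw [grrComp_apply, brProfile_of_le hε (by linarith [ht.1]),
    brProfile_of_mem hε ⟨by linarith [ht.2], by linarith [ht.1]⟩, yFun]
  ring_nf

theorem eqOn_zFun (hε : 0 < ε) (hεg : 0 ≤ εg) :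
    Set.EqOn (fun t => (1 - q (2 * ε) ε) * grrComp ε t (brProfile ε) (εg - ε + 2 * ε))
      (zFun ε εg) (Set.Icc εg ε) := by
  intro t ht
  dsimp only
  rw [grrComp_apply, brProfile_of_mem hε ⟨by linarith [ht.2], by linarith [ht.1]⟩,
    brProfile_of_ge hε (by linarith [ht.2]), zFun]
  ring_nf

theorem mul_classComp_brProfile_eq_max (hε : 0 < ε) (hεg : εg ∈ Set.Icc 0 ε) {c s : ℝ}
    (hc : 0 ≤ c) {G H : ℝ → ℝ}
    (hG : Set.EqOn (fun t => c * grrComp ε t (brProfile ε) s) G (Set.Ico 0 εg))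
    (hH : Set.EqOn (fun t => c * grrComp ε t (brProfile ε) s) H (Set.Icc εg ε)) :
    c * classComp ε (Set.Icc 0 ε) (brProfile ε) s
      = max (sSup (G '' Set.Ico 0 εg)) (sSup (H '' Set.Icc εg ε)) := by
  rw [classComp, ← sSup_image_mul hc]
  exact sSup_image_Icc_eq_max hεg (isCompact_Icc.bddAbove_image (by fun_prop))
    (fun t ht => mul_nonneg hc (grrComp_nonneg hε ht (brProfile_nonneg hε) s)) hG hH

theorem grrComp_classComp_brProfile_eq (hε : 0 < ε) (hεg : εg ∈ Set.Icc 0 ε) :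
    grrComp (2 * ε) ε (classComp ε (Set.Icc 0 ε) (brProfile ε)) εg
      = max (sSup (xFun ε εg '' Set.Ico 0 εg)) (sSup (yFun ε εg '' Set.Icc εg ε))
        + sSup (zFun ε εg '' Set.Icc εg ε) := by
  have hq : q (2 * ε) ε ∈ Set.Icc 0 1 := q_mem_Icc (by positivity) ⟨hε.le, by linarith⟩
  have hq' := sub_nonneg.2 hq.2
  have hz₀ : 0 ≤ sSup (zFun ε εg '' Set.Icc εg ε) := by
    refine Real.sSup_nonneg (Set.forall_mem_image.2 fun t ht => ?_)
    rw [← eqOn_zFun hε hεg.1 ht]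
    exact mul_nonneg hq' (grrComp_nonneg hε ⟨hεg.1.trans ht.1, ht.2⟩ (brProfile_nonneg hε) _)
  have hz : Set.EqOn (fun t => (1 - q (2 * ε) ε) * grrComp ε t (brProfile ε) (εg - ε + 2 * ε))
      (fun _ => 0) (Set.Ico 0 εg) := fun t ht => by
    dsimp only
    rw [grrComp_brProfile_eq_zero hε (by linarith [ht.2]), mul_zero]
  have hzero : sSup ((fun _ => (0 : ℝ)) '' Set.Ico 0 εg) = 0 := by
    rw [sSup_image', Real.iSup_const_zero]
  rw [grrComp_apply,
    mul_classComp_brProfile_eq_max hε hεg hq.1 (eqOn_xFun hε hεg.2) (eqOn_yFun hε hεg.1),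
    mul_classComp_brProfile_eq_max hε hεg hq' hz (eqOn_zFun hε hεg.1),
    hzero, max_eq_right hz₀]

theorem classComp_grrComp_brProfile_eq (hε : 0 < ε) (hεg : εg ∈ Set.Icc 0 ε) :
    classComp ε (Set.Icc 0 ε) (grrComp (2 * ε) ε (brProfile ε)) εg
      = max (sSup (xFun ε εg '' Set.Ico 0 εg))
          (sSup ((fun t => yFun ε εg t + zFun ε εg t) '' Set.Icc εg ε)) := by
  have hmem : ε ∈ Set.Icc 0 (2 * ε) := ⟨hε.le, by linarith⟩
  refine sSup_image_Icc_eq_max hεg (bddAbove_grrComp_image isCompact_Icc (by fun_prop) _ _)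
    (fun t ht => grrComp_nonneg hε ht
      (fun s => grrComp_nonneg (by positivity) hmem (brProfile_nonneg hε) s) _)
    (fun t ht => ?_) fun t ht => ?_
  · have hzero : grrComp ε t (brProfile ε) (εg - ε + 2 * ε) = 0 :=
      grrComp_brProfile_eq_zero hε (by linarith [ht.2])
    rw [grrComp_comm, grrComp_apply, hzero, mul_zero, add_zero, ← eqOn_xFun hε hεg.2 ht]
  · rw [grrComp_comm, grrComp_apply, ← eqOn_yFun hε hεg.1 ht, ← eqOn_zFun hε hεg.1 ht]

end OptimalDelta

end PrivacyComp

theorem mainTheorem7 {X : Type*} (Adj : X → X → Prop)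
    (hsymm : ∀ x x', Adj x x' → Adj x' x)
    (hne : ∃ x x', x ≠ x' ∧ Adj x x')
    (ε εg : ℝ) (hε : 0 < ε) (hεg : 0 ≤ εg) :
    (ε ≤ εg →
      PrivacyComp.deltaOpt Adj (PrivacyComp.Adaptive (PrivacyComp.BR Adj ε)
          (PrivacyComp.BR Adj ε) (PrivacyComp.DP Adj ε)) εg
        = PrivacyComp.deltaOpt Adj (PrivacyComp.Adaptive (PrivacyComp.BR Adj ε)
          (PrivacyComp.DP Adj ε) (PrivacyComp.BR Adj ε)) εg
      ∧ PrivacyComp.deltaOpt Adj (PrivacyComp.Adaptive (PrivacyComp.BR Adj ε)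
          (PrivacyComp.DP Adj ε) (PrivacyComp.BR Adj ε)) εg
        = PrivacyComp.deltaOpt Adj (PrivacyComp.Adaptive (PrivacyComp.DP Adj ε)
          (PrivacyComp.BR Adj ε) (PrivacyComp.BR Adj ε)) εg)
    ∧ (εg ≤ ε →
      PrivacyComp.deltaOpt Adj (PrivacyComp.Adaptive (PrivacyComp.DP Adj ε)
          (PrivacyComp.BR Adj ε) (PrivacyComp.BR Adj ε)) εg
        = max (sSup (PrivacyComp.xFun ε εg '' Set.Ico 0 εg))
              (sSup (PrivacyComp.yFun ε εg '' Set.Icc εg ε))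
          + sSup (PrivacyComp.zFun ε εg '' Set.Icc εg ε)
      ∧ PrivacyComp.deltaOpt Adj (PrivacyComp.Adaptive (PrivacyComp.BR Adj ε)
          (PrivacyComp.DP Adj ε) (PrivacyComp.BR Adj ε)) εg
        = max (sSup (PrivacyComp.xFun ε εg '' Set.Ico 0 εg))
              (sSup ((fun t => PrivacyComp.yFun ε εg t + PrivacyComp.zFun ε εg t)
                '' Set.Icc εg ε))
      ∧ PrivacyComp.deltaOpt Adj (PrivacyComp.Adaptive (PrivacyComp.BR Adj ε)
          (PrivacyComp.BR Adj ε) (PrivacyComp.DP Adj ε)) εg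
        = max (sSup (PrivacyComp.xFun ε εg '' Set.Ico 0 εg))
              (sSup ((fun t => PrivacyComp.yFun ε εg t + PrivacyComp.zFun ε εg t)
                '' Set.Icc εg ε))) := by
  have hD := PrivacyComp.isGRRClass_DP hsymm hε
  have hB := PrivacyComp.isGRRClass_BR (Adj := Adj) hε
  simp only [PrivacyComp.deltaOpt_adaptive hB hB hD hne,
    PrivacyComp.deltaOpt_adaptive hB hD hB hne, PrivacyComp.deltaOpt_adaptive hD hB hB hne,
    PrivacyComp.classComp_singleton, PrivacyComp.classComp_grrComp_nullProfile hε]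
  refine ⟨fun h => ⟨rfl, ?_⟩, fun h => ⟨?_, ?_, ?_⟩⟩
  · exact PrivacyComp.classComp_grrComp_brProfile_of_le hε h
  · exact PrivacyComp.grrComp_classComp_brProfile_eq hε ⟨hεg, h⟩
  · exact PrivacyComp.classComp_grrComp_brProfile_eq hε ⟨hεg, h⟩
  · exact PrivacyComp.classComp_grrComp_brProfile_eq hε ⟨hεg, h⟩
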